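/- Let $\Omega\subset\mathbb R^\ell$, $\ell\in\{2,3\}$, be a bounded open set; $(\cdot,\cdot)$ and $\|\cdot\|$ are the $L^2(\Omega)$ inner product and norm, $\|A\|_F$ is the Frobenius norm of a matrix, and $b^*(u,v,w)=\tfrac12\big((u\cdot\nabla v,w)-(u\cdot\nabla w,v)\big)$. Let $\varphi_1,\dots,\varphi_d\in W^{1,2}_0(\Omega)^\ell$ be $L^2$-orthonormal (for example a POD basis), $X_r=\mathrm{span}\{\varphi_1,\dots,\varphi_r\}$ for $1\le r\le d$, and $P_r$ the $L^2$ projection onto $X_r$. Let $\mathrm{Re},\Delta t,C_S>0$, $M\in\mathbb N$, $t^n=n\Delta t$, and $f(t)\in L^2(\Omega)^\ell$. For $1\le r\le d$ let $u_r^0,\dots,u_r^M\in X_r$ be a solution of the G-ROM: for $n=1,\dots,M$ and all $v\in X_r$, $$\Big(\tfrac{u_r^n-u_r^{n-1}}{\Delta t},v\Big)+\mathrm{Re}^{-1}(\nabla u_r^n,\nabla v)+b^*(u_r^n,u_r^n,v)=(f(t^n),v),\qquad u_r^0=P_r(u_d^0).$$ For a lengthscale $\delta>0$ the L-ROM with parameters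 $\mu,s$ is to find $w_r^0,\dots,w_r^M\in X_r$ with $w_r^0=P_r(u_d^0)$ such that, for $n=1,\dots,M$ and all $v\in X_r$, $$\Big(\tfrac{w_r^n-w_r^{n-1}}{\Delta t},v\Big)+\mathrm{Re}^{-1}(\nabla w_r^n,\nabla v)+(C_S\delta)^\mu\big(\|\nabla w_r^n\|_F^s\nabla w_r^n,\nabla v\big)+b^*(w_r^n,w_r^n,v)=(f(t^n),v).$$ The S-ROM is the L-ROM with $\mu=2$, $s=1$. Put $|||e|||_{\infty,0}=\max_{0\le n\le M}\|e^n\|$. A ROM of this kind is called limit consistent (in the norm $|||\cdot|||_{\infty,0}$) if there is a function $B(\delta,r)$ such that $|||u_d-w_r|||_{\infty,0}\le B(\delta,r)$ for all $\delta>0$, all $1\le r\le d$ and every solution $w_r$; $B$ decreases as $\delta$ decreases and as $r$ increases through $1,\dots,d$; and $B(\delta,d)\to0$ as $\delta\to0^+$. Theorem. There is a constant $C>0$ depending only on $\Omega$ (and $\ell$) such that the following holds whenever the time step is so small that $\Delta t\,C\big(\mathrm{Re}^3\|\nabla u_r^n\|^4+1\big)<1$ for all $1\le r\le d$, $1\le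 n\le M$. Let $\mu>0$ and $s\ge0$, let $\nabla\varphi_j\in L^{s+2}(\Omega)$ for all $j$ (so that the L-ROM is well defined), and suppose that $\nabla u_r\in L^{2s+2}(0,T;L^{2s+2}(\Omega))$ in the discrete sense, i.e. $\nabla u_r^n\in L^{2s+2}(\Omega)$ for $1\le r\le d$ and $1\le n\le M$. Then: 1. the L-ROM is limit consistent; 2. for every $1\le r\le d$ and $\delta>0$, $$\Delta t\sum_{n=1}^M\big\|(C_S\delta)^\mu\|\nabla u_r^n\|_F^s\nabla u_r^n\big\|^2=(C_S\delta)^{2\mu}\,\Delta t\sum_{n=1}^M\|\nabla u_r^n\|_{L^{2s+2}}^{2s+2},$$ and this quantity tends to $0$ as $\delta\to0^+$; 3. for every $1\le r\le d$ there is a constant $A$, independent of $\delta$, with $|||u_r-w_r|||_{\infty,0}\le A\,\delta^\mu$ for every $\delta>0$ and every L-ROM solution $w_r$. In particular, if $\nabla\varphi_j\in L^3(\Omega)$ and $\nabla u_r^n\in L^4(\Omega)$ for all $j$, $r$ and $1\le n\le M$, then the S-ROM is limit consistent and $|||u_r-w_r|||_{\infty,0}\le A\,\delta^2$ for every $\delta>0$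 and every S-ROM solution $w_r$, with $A$ independent of $\delta$. -/

import Mathlib

open MeasureTheory Filter Topology
open scoped ENNReal ContDiff

noncomputable section

namespace LESROM

/-- The ambient Euclidean space `ℝ^ℓ`; also the space of velocity values. -/
abbrev Pt (ℓ : ℕ) : Type := EuclideanSpace ℝ (Fin ℓ)

/-- Real `ℓ × ℓ` matrices with the Frobenius norm and inner product; the entry `(i, j)` of a
velocity gradient is `∂ⱼ uᵢ`. -/
abbrev Mat (ℓ : ℕ) : Type := EuclideanSpace ℝ (Fin ℓ × Fin ℓ)

/-- `L²(Ω)^ℓ`. -/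
abbrev L2Vel {ℓ : ℕ} (Ω : Set (Pt ℓ)) : Type := Lp (Pt ℓ) 2 (volume.restrict Ω)

/-- `L²(Ω)^{ℓ × ℓ}`. -/
abbrev L2Mat {ℓ : ℕ} (Ω : Set (Pt ℓ)) : Type := Lp (Mat ℓ) 2 (volume.restrict Ω)

/-- The classical gradient (Jacobian matrix) of a differentiable vector field. -/
def jacobian {ℓ : ℕ} (φ : Pt ℓ → Pt ℓ) (x : Pt ℓ) : Mat ℓ :=
  WithLp.toLp 2 fun ij => fderiv ℝ φ x (EuclideanSpace.single ij.2 1) ij.1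

/-- The pairs `(φ, ∇φ)` with `φ` a smooth vector field, compactly supported in `Ω`. -/
def testPairs {ℓ : ℕ} (Ω : Set (Pt ℓ)) : Set (L2Vel Ω × L2Mat Ω) :=
  {p | ∃ φ : Pt ℓ → Pt ℓ, ContDiff ℝ ∞ φ ∧ HasCompactSupport φ ∧ tsupport φ ⊆ Ω ∧
    p.1 =ᵐ[volume.restrict Ω] φ ∧ p.2 =ᵐ[volume.restrict Ω] jacobian φ}

/-- `W₀^{1,2}(Ω)^ℓ`, the closure of the test fields in the `W^{1,2}` topology. A field `u` is
stored together with its weak gradient, as the pair `(u, ∇u)`. -/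
def H01 {ℓ : ℕ} (Ω : Set (Pt ℓ)) : Submodule ℝ (L2Vel Ω × L2Mat Ω) :=
  (Submodule.span ℝ (testPairs Ω)).topologicalClosure

variable {ℓ : ℕ} {Ω : Set (Pt ℓ)}

/-- The velocity field, as an element of `L²`. -/
def vel (u : H01 Ω) : L2Vel Ω := u.1.1

/-- The weak gradient, as an element of `L²`. -/
def grad (u : H01 Ω) : L2Mat Ω := u.1.2

/-- `b(u, v, w) = (u · ∇v, w)`. -/
def triB (u v w : H01 Ω) : ℝ :=
  ∫ x in Ω, ∑ i, ∑ j, vel u x j * grad v x (i, j) * vel w x i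

/-- The skew-symmetric form `b*(u, v, w) = ½ (b(u, v, w) - b(u, w, v))`. -/
def triBStar (u v w : H01 Ω) : ℝ := (1 / 2) * (triB u v w - triB u w v)

/-- `X_r`, the span of the first `r` members of the ROM basis. -/
def romSpace {d : ℕ} (φ : Fin d → H01 Ω) (r : ℕ) : Submodule ℝ (H01 Ω) :=
  Submodule.span ℝ {v | ∃ j : Fin d, j.val < r ∧ v = φ j}

/-- `p` is the `L²` projection of `u` onto `X`. -/
def IsL2Proj (X : Submodule ℝ (H01 Ω)) (u p : H01 Ω) : Prop :=
  p ∈ X ∧ ∀ v ∈ X, inner ℝ (vel p) (vel v) = inner ℝ (vel u) (vel v)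

/-- `w⁰, …, w^M ∈ X` solve the backward Euler LES-ROM posed on `X`; the closure term enters
through the form `τ w v = (τ^ROM(w), v)`. -/
def IsLESROMSolution (X : Submodule ℝ (H01 Ω)) (Re Δt : ℝ) (M : ℕ) (f : ℝ → L2Vel Ω)
    (τ : H01 Ω → H01 Ω → ℝ) (w : ℕ → H01 Ω) : Prop :=
  (∀ n ≤ M, w n ∈ X) ∧
  ∀ n < M, ∀ v ∈ X,
    (1 / Δt) * inner ℝ (vel (w (n + 1)) - vel (w n)) (vel v)
      + Re⁻¹ * inner ℝ (grad (w (n + 1))) (grad v)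
      + triBStar (w (n + 1)) (w (n + 1)) v
      + τ (w (n + 1)) v
      = inner ℝ (f (((n + 1 : ℕ) : ℝ) * Δt)) (vel v)

/-- The G-ROM is posed without closure term. -/
def IsGROMSolution (X : Submodule ℝ (H01 Ω)) (Re Δt : ℝ) (M : ℕ) (f : ℝ → L2Vel Ω)
    (u : ℕ → H01 Ω) : Prop :=
  IsLESROMSolution X Re Δt M f (fun _ _ => 0) u

/-- The closure term of the L-ROM, `(C_S δ)^μ (‖∇w‖_F^s ∇w, ∇v)`, that is, the weak form of
`-(C_S δ)^μ ∇ · (‖∇w‖_F^s ∇w)`. -/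
def ladyzhenskayaClosure (CS μ s δ : ℝ) (w v : H01 Ω) : ℝ :=
  (CS * δ) ^ μ * ∫ x in Ω, ‖grad w x‖ ^ s * inner ℝ (grad w x) (grad v x)

/-- The closure term of the S-ROM, `(C_S δ)² (‖∇w‖_F ∇w, ∇v)`. -/
def smagorinskyClosure (CS δ : ℝ) (w v : H01 Ω) : ℝ :=
  (CS * δ) ^ 2 * ∫ x in Ω, ‖grad w x‖ * inner ℝ (grad w x) (grad v x)

/-- The `W^{k,2}` norm for `k = 0, 1`, the orders available on `W₀^{1,2}`. -/
def sobolevNorm (k : Fin 2) (u : H01 Ω) : ℝ :=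
  if k = 0 then ‖vel u‖ else Real.sqrt (‖vel u‖ ^ 2 + ‖grad u‖ ^ 2)

/-- The discrete norm `|||e|||_{m,k}` over the time levels `0, …, M`. -/
def triNorm (m : ℝ≥0∞) (k : Fin 2) (Δt : ℝ) (M : ℕ) (e : ℕ → H01 Ω) : ℝ :=
  if m = ⊤ then
    (Finset.range (M + 1)).sup' Finset.nonempty_range_add_one fun n => sobolevNorm k (e n)
  else
    (∑ n ∈ Finset.range (M + 1), sobolevNorm k (e n) ^ m.toReal * Δt) ^ (1 / m.toReal)

/-- Limit consistency, in the norm `|||·|||_{m,k}`, of the LES-ROMs with the closure terms `τ δ`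
(`δ > 0`) and initial values `P_r(u_d⁰)`: there is a bound `B δ r`, valid for every LES-ROM
solution, that decreases as `δ` decreases and as `r` increases through `1, …, d`, and that tends
to `0` with `δ` when `r = d`. -/
def IsLimitConsistent (m : ℝ≥0∞) (k : Fin 2) {d : ℕ} (φ : Fin d → H01 Ω) (Re Δt : ℝ) (M : ℕ)
    (f : ℝ → L2Vel Ω) (ud : ℕ → H01 Ω) (τ : ℝ → H01 Ω → H01 Ω → ℝ) : Prop :=
  ∃ B : ℝ → ℕ → ℝ,
    (∀ δ > 0, ∀ r ∈ Set.Icc 1 d, ∀ w : ℕ → H01 Ω,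
      IsLESROMSolution (romSpace φ r) Re Δt M f (τ δ) w →
      IsL2Proj (romSpace φ r) (ud 0) (w 0) →
      triNorm m k Δt M (fun n => ud n - w n) ≤ B δ r) ∧
    (∀ r ∈ Set.Icc 1 d, StrictMonoOn (fun δ => B δ r) (Set.Ioi 0)) ∧
    (∀ δ > 0, StrictAntiOn (fun r => B δ r) (Set.Icc 1 d)) ∧
    Tendsto (fun δ => B δ d) (𝓝[>] 0) (𝓝 0)

/-- The LES-ROM solutions of dimension `r` converge to the G-ROM solution `ur` at the rate
`O(δ^μ)` in the norm `|||·|||_{∞,0}`. -/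
def ConvergesAtRate (μ : ℝ) {d : ℕ} (φ : Fin d → H01 Ω) (r : ℕ) (Re Δt : ℝ) (M : ℕ)
    (f : ℝ → L2Vel Ω) (ur : ℕ → H01 Ω) (τ : ℝ → H01 Ω → H01 Ω → ℝ) : Prop :=
  ∃ A : ℝ, ∀ δ > 0, ∀ w : ℕ → H01 Ω,
    IsLESROMSolution (romSpace φ r) Re Δt M f (τ δ) w →
    IsL2Proj (romSpace φ r) (ur 0) (w 0) →
    triNorm ⊤ 0 Δt M (fun n => ur n - w n) ≤ A * δ ^ μ

/-- `Δt ∑_{n=1}^M ‖(C_S δ)^μ ‖∇uⁿ‖_F^s ∇uⁿ‖²`, the accumulated squared `L²` size of the eddy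
viscosity stress. -/
def closureSize (CS μ s Δt : ℝ) (M : ℕ) (u : ℕ → H01 Ω) (δ : ℝ) : ℝ :=
  Δt * ∑ n ∈ Finset.Icc 1 M,
    ∫ x in Ω, ‖((CS * δ) ^ μ * ‖grad (u n) x‖ ^ s) • grad (u n) x‖ ^ 2

/-- `|||∇u|||_{p,p}^p = Δt ∑_{n=1}^M ‖∇uⁿ‖_p^p`. -/
def gradPowSum (p Δt : ℝ) (M : ℕ) (u : ℕ → H01 Ω) : ℝ :=
  Δt * ∑ n ∈ Finset.Icc 1 M, ∫ x in Ω, ‖grad (u n) x‖ ^ p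

end LESROM

end

open LESROM

/-! The theorem rests on an energy estimate for the error e = u_r − w_r between the G-ROM and the
L-ROM on the same space X_r. Subtract the two schemes and test with e at the new time level.
Skew-symmetry reduces the convective terms to b*(e, u, e) (`triBStar_self_sub_triBStar_self`). A
Sobolev embedding into L⁶ and Young's inequality bound this by a quarter of the viscous term plus C
Re³‖∇u‖⁴‖e‖² (`exists_triBStar_le`). The closure is monotone, so w may be replaced by u in it. What
remains is the stress of the G-ROM solution, at most another quarter of the viscous term plus a
multiple of δ^(2μ)‖∇u‖_{2s+2}^{2s+2} (`ladyzhenskayaClosure_monotone`, `ladyzhenskayaClosure_le`).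

The small time step keeps the coefficient of the new ‖e‖² positive. The initial velocities agree, so
recursion over the finitely many steps gives ‖e‖ ≤ A δ^μ (`exists_error_bound`).

Limit consistency then follows from u_d − w_r = (u_d − u_r) + (u_r − w_r): the first part vanishes
at r = d and is bounded over the finitely many r, the second is O(δ^μ). -/

open scoped NNReal

namespace LESROM

/-! ### Sobolev embedding into L⁶ -/

section Sobolev

variable {ℓ : ℕ} {Ω : Set (Pt ℓ)}

theorem jacobian_zero : jacobian (0 : Pt ℓ → Pt ℓ) = 0 := by
  ext x ij
  simp [jacobian]

theorem jacobian_add {φ ψ : Pt ℓ → Pt ℓ} (hφ : Differentiable ℝ φ) (hψ : Differentiable ℝ ψ) :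
    jacobian (φ + ψ) = jacobian φ + jacobian ψ := by
  ext x ij
  simp [jacobian, fderiv_add (hφ x) (hψ x)]

theorem jacobian_smul (c : ℝ) {φ : Pt ℓ → Pt ℓ} (hφ : Differentiable ℝ φ) :
    jacobian (c • φ) = c • jacobian φ := by
  ext x ij
  simp [jacobian, fderiv_const_smul (hφ x) c]

/-- The test fields form a linear space. -/
theorem mem_testPairs_of_mem_span {p : L2Vel Ω × L2Mat Ω}
    (hp : p ∈ Submodule.span ℝ (testPairs Ω)) : p ∈ testPairs Ω := by
  induction hp using Submodule.span_induction with
  | mem p hp => exact hp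
  | zero =>
    refine ⟨0, contDiff_const, HasCompactSupport.zero, by simp [tsupport], Lp.coeFn_zero _ _ _, ?_⟩
    rw [jacobian_zero]
    exact Lp.coeFn_zero _ _ _
  | add p q _ _ hp hq =>
    obtain ⟨φ, hφ, hφc, hφs, hp1, hp2⟩ := hp
    obtain ⟨ψ, hψ, hψc, hψs, hq1, hq2⟩ := hq
    refine ⟨φ + ψ, hφ.add hψ, hφc.add hψc,
      (tsupport_add φ ψ).trans (Set.union_subset hφs hψs), ?_, ?_⟩
    · exact (Lp.coeFn_add p.1 q.1).trans (hp1.add hq1)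
    · rw [jacobian_add (hφ.differentiable (by simp)) (hψ.differentiable (by simp))]
      exact (Lp.coeFn_add p.2 q.2).trans (hp2.add hq2)
  | smul c p _ hp =>
    obtain ⟨φ, hφ, hφc, hφs, hp1, hp2⟩ := hp
    refine ⟨c • φ, hφ.const_smul c, hφc.smul_left (f := fun _ => c),
      (closure_mono (Function.support_const_smul_subset c φ)).trans hφs, ?_, ?_⟩
    · exact (Lp.coeFn_smul c p.1).trans (hp1.const_smul c)
    · rw [jacobian_smul c (hφ.differentiable (by simp))]
      exact (Lp.coeFn_smul c p.2).trans (hp2.const_smul c)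

/-- The operator norm of the derivative is at most the Frobenius norm of the Jacobian. -/
theorem norm_fderiv_le_norm_jacobian (φ : Pt ℓ → Pt ℓ) (x : Pt ℓ) :
    ‖fderiv ℝ φ x‖ ≤ ‖jacobian φ x‖ := by
  refine ContinuousLinearMap.opNorm_le_bound _ (norm_nonneg _) fun v => ?_
  have hv : ∀ i, fderiv ℝ φ x v i = ∑ j, jacobian φ x (i, j) * v j := by
    intro i
    have : v = ∑ j, v j • EuclideanSpace.single j (1 : ℝ) := by
      ext k
      simp [Finset.sum_apply, Pi.single_apply]
    conv_lhs => rw [this]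
    simp [jacobian, mul_comm]
  refine le_of_sq_le_sq ?_ (by positivity)
  rw [mul_pow, EuclideanSpace.norm_sq_eq, EuclideanSpace.norm_sq_eq, EuclideanSpace.norm_sq_eq,
    Fintype.sum_prod_type, Finset.sum_mul]
  refine Finset.sum_le_sum fun i _ => ?_
  rw [hv]
  simp only [Real.norm_eq_abs, sq_abs]
  exact Finset.sum_mul_sq_le_sq_mul_sq _ _ _

theorem isFiniteMeasure_restrict_of_isBounded (hΩ : Bornology.IsBounded Ω) :
    IsFiniteMeasure (volume.restrict Ω) :=
  isFiniteMeasure_restrict.2 hΩ.measure_lt_top.ne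

/-- In both dimensions 6 is exactly the Sobolev conjugate of p. For ℓ = 3 one takes p = 2; for ℓ = 2
the exponent 2 is critical, so p = 3/2. -/
theorem exists_sobolev_exponent (hℓ : ℓ = 2 ∨ ℓ = 3) :
    ∃ p : ℝ≥0, 1 ≤ p ∧ p ≤ 2 ∧ p < Module.finrank ℝ (Pt ℓ) ∧
      p⁻¹ - (Module.finrank ℝ (Pt ℓ) : ℝ)⁻¹ ≤ ((6 : ℝ≥0) : ℝ)⁻¹ := by
  rcases hℓ with rfl | rfl
  · refine ⟨3 / 2, ?_, ?_, ?_, ?_⟩ <;> simp only [finrank_euclideanSpace_fin, ← NNReal.coe_le_coe,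
      ← NNReal.coe_lt_coe] <;> norm_num
  · refine ⟨2, ?_, ?_, ?_, ?_⟩ <;> simp only [finrank_euclideanSpace_fin, ← NNReal.coe_le_coe,
      ← NNReal.coe_lt_coe] <;> norm_num

/-- The Sobolev embedding of test fields into `L⁶`. -/
theorem exists_eLpNorm_test_le (hℓ : ℓ = 2 ∨ ℓ = 3) (hΩb : Bornology.IsBounded Ω) :
    ∃ K : ℝ≥0, ∀ φ : Pt ℓ → Pt ℓ, ContDiff ℝ ∞ φ → tsupport φ ⊆ Ω →
      AEStronglyMeasurable (jacobian φ) (volume.restrict Ω) →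
      eLpNorm φ 6 (volume.restrict Ω) ≤ K * eLpNorm (jacobian φ) 2 (volume.restrict Ω) := by
  have := isFiniteMeasure_restrict_of_isBounded hΩb
  obtain ⟨p, hp1, hp2, hpℓ, hp⟩ := exists_sobolev_exponent hℓ
  obtain ⟨c, hc⟩ : ∃ c : ℝ≥0, ∀ φ : Pt ℓ → Pt ℓ, ContDiff ℝ 1 φ → Function.support φ ⊆ Ω →
      eLpNorm φ ((6 : ℝ≥0) : ℝ≥0∞) volume ≤ c * eLpNorm (fderiv ℝ φ) p volume :=
    ⟨_, fun φ hφ hs => eLpNorm_le_eLpNorm_fderiv_of_le (volume : Measure (Pt ℓ)) hφ hs hp1 hpℓ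
      hp hΩb⟩
  -- Cost of passing from L^p to L² on the bounded domain.
  obtain ⟨m, hm⟩ : ∃ m : ℝ≥0, (volume.restrict Ω) Set.univ ^
      (1 / (p : ℝ≥0∞).toReal - 1 / (2 : ℝ≥0∞).toReal) = m := by
    refine ⟨_, (ENNReal.coe_toNNReal
      (ENNReal.rpow_lt_top_of_nonneg ?_ (measure_ne_top _ _)).ne).symm⟩
    simp only [ENNReal.coe_toReal, ENNReal.toReal_ofNat, sub_nonneg]
    have h2 : (p : ℝ) ≤ 2 := by exact_mod_cast hp2
    have h1 : (1 : ℝ) ≤ p := by exact_mod_cast hp1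
    gcongr
  refine ⟨c * m, fun φ hφ hs hmeas => ?_⟩
  have hsup : Function.support φ ⊆ Ω := (subset_tsupport φ).trans hs
  have h1 := hc φ (hφ.of_le (by simp)) hsup
  have hJsup : Function.support (jacobian φ) ⊆ Ω := by
    refine Set.Subset.trans (fun x hx => ?_) ((support_fderiv_subset ℝ).trans hs)
    intro h
    exact hx (by ext ij; simp [jacobian, h])
  have hφΩ : eLpNorm φ 6 (volume.restrict Ω) = eLpNorm φ 6 volume :=
    eLpNorm_restrict_eq_of_support_subset hsup
  have hJΩ : eLpNorm (jacobian φ) p (volume.restrict Ω) = eLpNorm (jacobian φ) p volume :=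
    eLpNorm_restrict_eq_of_support_subset hJsup
  calc eLpNorm φ 6 (volume.restrict Ω)
      ≤ c * eLpNorm (fderiv ℝ φ) p volume := hφΩ.trans_le h1
    _ ≤ c * eLpNorm (jacobian φ) p (volume.restrict Ω) := by
        rw [hJΩ]
        gcongr
        exact eLpNorm_mono (norm_fderiv_le_norm_jacobian φ)
    _ ≤ c * (eLpNorm (jacobian φ) 2 (volume.restrict Ω) * m) := by
        gcongr
        rw [← hm]
        exact eLpNorm_le_eLpNorm_mul_rpow_measure_univ (by exact_mod_cast hp2) hmeas
    _ = _ := by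
        rw [ENNReal.coe_mul, mul_assoc, mul_comm (m : ℝ≥0∞)]

/-- The Sobolev embedding of `W₀^{1,2}(Ω)^ℓ` into `L⁶`. -/
theorem exists_eLpNorm_vel_le (hℓ : ℓ = 2 ∨ ℓ = 3) (hΩb : Bornology.IsBounded Ω) :
    ∃ K : ℝ≥0, ∀ u : H01 Ω, eLpNorm (vel u) 6 (volume.restrict Ω) ≤ K * ‖grad u‖ₑ := by
  obtain ⟨K, hK⟩ := exists_eLpNorm_test_le hℓ hΩb
  refine ⟨K, fun u => ?_⟩
  obtain ⟨p, hp, hpu⟩ := mem_closure_iff_seq_limit.1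
    (show u.1 ∈ closure (Submodule.span ℝ (testPairs Ω) : Set (L2Vel Ω × L2Mat Ω)) from u.2)
  have hbound : ∀ n, eLpNorm (p n).1 6 (volume.restrict Ω) ≤ K * ‖(p n).2‖ₑ := by
    intro n
    obtain ⟨φ, hφ, -, hφs, h1, h2⟩ := mem_testPairs_of_mem_span (hp n)
    rw [eLpNorm_congr_ae h1, Lp.enorm_def, eLpNorm_congr_ae h2]
    exact hK φ hφ hφs ((Lp.aestronglyMeasurable _).congr h2)
  have hlim1 : Tendsto (fun n => (p n).1) atTop (𝓝 (vel u)) := (continuous_fst.tendsto _).comp hpu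
  have hlim2 : Tendsto (fun n => (p n).2) atTop (𝓝 (grad u)) := (continuous_snd.tendsto _).comp hpu
  -- L² convergence gives an a.e. convergent subsequence, along which Fatou's lemma carries the L⁶
  -- bound to the limit.
  obtain ⟨ns, hns, hae⟩ := (tendstoInMeasure_of_tendsto_Lp hlim1).exists_seq_tendsto_ae
  refine (Lp.eLpNorm_lim_le_liminf_eLpNorm (fun n => Lp.aestronglyMeasurable (p (ns n)).1)
    (vel u) hae).trans ?_
  have hlim : Tendsto (fun n => (K : ℝ≥0∞) * ‖(p (ns n)).2‖ₑ) atTop (𝓝 (K * ‖grad u‖ₑ)) :=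
    ENNReal.Tendsto.const_mul
      ((continuous_enorm.tendsto _).comp (hlim2.comp hns.tendsto_atTop)) (Or.inr ENNReal.coe_ne_top)
  rw [← hlim.liminf_eq]
  exact liminf_le_liminf (Eventually.of_forall fun n => hbound (ns n))

end Sobolev

end LESROM
namespace LESROM

/-! ### The convective form -/

section Trilinear

theorem eLpNorm_natCast_eq {α E : Type*} [MeasurableSpace α] {μ : Measure α}
    [NormedAddCommGroup E] (h : α → E) (n : ℕ) [NeZero n] :
    eLpNorm h n μ = (∫⁻ x, ‖h x‖ₑ ^ (n : ℝ) ∂μ) ^ (1 / (n : ℝ)) := by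
  rw [eLpNorm_eq_lintegral_rpow_enorm_toReal (by exact_mod_cast NeZero.ne n) (by simp)]
  simp

/-- Hölder's inequality for the convective term, with exponents `3`, `6` and `2`, the `L³` norm
being interpolated between `L²` and `L⁶`. -/
theorem lintegral_mul_mul_le {α E F G : Type*} [MeasurableSpace α] {μ : Measure α}
    [NormedAddCommGroup E] [NormedAddCommGroup F] [NormedAddCommGroup G]
    {e : α → E} {v : α → F} {g : α → G} (he : AEStronglyMeasurable e μ)
    (hv : AEStronglyMeasurable v μ) (hg : AEStronglyMeasurable g μ) :
    ∫⁻ x, ‖e x‖ₑ * ‖v x‖ₑ * ‖g x‖ₑ ∂μ ≤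
      eLpNorm e 2 μ ^ (1 / 2 : ℝ) * eLpNorm e 6 μ ^ (1 / 2 : ℝ) * eLpNorm v 6 μ *
        eLpNorm g 2 μ := by
  -- The weights sum to 1. The factor ‖e‖ is split as (‖e‖²)^(1/4) (‖e‖⁶)^(1/12), which builds the
  -- interpolation into Hölder's inequality.
  have key := ENNReal.lintegral_prod_norm_pow_le (μ := μ) (Finset.univ : Finset (Fin 4))
    (f := ![fun x => ‖e x‖ₑ ^ (2 : ℝ), fun x => ‖e x‖ₑ ^ (6 : ℝ), fun x => ‖v x‖ₑ ^ (6 : ℝ),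
      fun x => ‖g x‖ₑ ^ (2 : ℝ)])
    (p := ![1 / 4, 1 / 12, 1 / 6, 1 / 2])
    (by
      intro i _
      fin_cases i
      exacts [he.enorm.pow_const _, he.enorm.pow_const _, hv.enorm.pow_const _,
        hg.enorm.pow_const _])
    (by simp [Fin.sum_univ_four]; norm_num)
    (by intro i _; fin_cases i <;> simp)
  have h2 := eLpNorm_natCast_eq (μ := μ) e 2
  have h6 := eLpNorm_natCast_eq (μ := μ) e 6
  have h6v := eLpNorm_natCast_eq (μ := μ) v 6
  have h2g := eLpNorm_natCast_eq (μ := μ) g 2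
  simp only [Nat.cast_ofNat] at h2 h6 h6v h2g
  rw [h2, h6, h6v, h2g]
  simp only [Fin.prod_univ_four, Matrix.cons_val_zero, Matrix.cons_val_one, Matrix.cons_val,
    ← ENNReal.rpow_mul] at key ⊢
  convert key using 3 with x
  · rw [← ENNReal.rpow_add_of_nonneg _ _ (by norm_num) (by norm_num)]
    norm_num
  all_goals norm_num

variable {ℓ : ℕ} {Ω : Set (Pt ℓ)}

/-- The convective density `(u · ∇v) · w`. -/
noncomputable def convDensity (u v w : H01 Ω) (x : Pt ℓ) : ℝ :=
  ∑ i, ∑ j, vel u x j * grad v x (i, j) * vel w x i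

theorem triB_eq_integral_convDensity (u v w : H01 Ω) :
    triB u v w = ∫ x in Ω, convDensity u v w x := rfl

theorem norm_convDensity_le (u v w : H01 Ω) (x : Pt ℓ) :
    ‖convDensity u v w x‖ ≤ (ℓ : ℝ) ^ 2 * (‖vel u x‖ * ‖vel w x‖ * ‖grad v x‖) := by
  have h : ∀ i j, ‖vel u x j * grad v x (i, j) * vel w x i‖ ≤
      ‖vel u x‖ * ‖vel w x‖ * ‖grad v x‖ := by
    intro i j
    rw [norm_mul, norm_mul, mul_right_comm]
    gcongr <;> exact PiLp.norm_apply_le _ _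
  calc ‖convDensity u v w x‖
      ≤ ∑ i, ∑ j, ‖vel u x j * grad v x (i, j) * vel w x i‖ :=
        (norm_sum_le _ _).trans (Finset.sum_le_sum fun i _ => norm_sum_le _ _)
    _ ≤ ∑ _i : Fin ℓ, ∑ _j : Fin ℓ, ‖vel u x‖ * ‖vel w x‖ * ‖grad v x‖ :=
        Finset.sum_le_sum fun i _ => Finset.sum_le_sum fun j _ => h i j
    _ = _ := by
        simp only [Finset.sum_const, Finset.card_univ, Fintype.card_fin, nsmul_eq_mul]
        ring

theorem aestronglyMeasurable_convDensity (u v w : H01 Ω) :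
    AEStronglyMeasurable (convDensity u v w) (volume.restrict Ω) := by
  have hc : ∀ {ι : Type} [Fintype ι] (f : Lp (EuclideanSpace ℝ ι) 2 (volume.restrict Ω)) (i : ι),
      AEStronglyMeasurable (fun x => f x i) (volume.restrict Ω) := fun f i =>
    (EuclideanSpace.proj (𝕜 := ℝ) i).continuous.comp_aestronglyMeasurable
      (Lp.aestronglyMeasurable f)
  unfold convDensity
  refine Finset.aestronglyMeasurable_fun_sum _ fun i _ =>
    Finset.aestronglyMeasurable_fun_sum _ fun j _ => ?_
  exact ((hc (vel u) j).mul (hc (grad v) (i, j))).mul (hc (vel w) i)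

/-- The bound is a coerced `ℝ≥0`, so it yields both integrability and the real estimate for b. -/
theorem lintegral_convDensity_le {K : ℝ≥0}
    (hK : ∀ u : H01 Ω, eLpNorm (vel u) 6 (volume.restrict Ω) ≤ K * ‖grad u‖ₑ) (u v w : H01 Ω) :
    ∫⁻ x in Ω, ‖convDensity u v w x‖ₑ ≤
      ((ℓ ^ 2 * (NNReal.sqrt ‖vel u‖₊ * NNReal.sqrt (K * ‖grad u‖₊) * (K * ‖grad w‖₊) *
        ‖grad v‖₊) : ℝ≥0) : ℝ≥0∞) := by
  have hb : ∀ x, ‖convDensity u v w x‖ₑ ≤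
      (ℓ : ℝ≥0∞) ^ 2 * (‖vel u x‖ₑ * ‖vel w x‖ₑ * ‖grad v x‖ₑ) := by
    intro x
    have := norm_convDensity_le u v w x
    have h : ‖convDensity u v w x‖₊ ≤ (ℓ : ℝ≥0) ^ 2 * (‖vel u x‖₊ * ‖vel w x‖₊ * ‖grad v x‖₊) := by
      exact_mod_cast this
    simp only [enorm_eq_nnnorm]
    exact_mod_cast h
  have hs : ∀ a : ℝ≥0, ((NNReal.sqrt a : ℝ≥0) : ℝ≥0∞) = (a : ℝ≥0∞) ^ (1 / 2 : ℝ) := by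
    intro a
    rw [NNReal.sqrt_eq_rpow, ENNReal.coe_rpow_of_nonneg _ (by norm_num)]
  calc ∫⁻ x in Ω, ‖convDensity u v w x‖ₑ
      ≤ ∫⁻ x in Ω, (ℓ : ℝ≥0∞) ^ 2 * (‖vel u x‖ₑ * ‖vel w x‖ₑ * ‖grad v x‖ₑ) :=
        lintegral_mono hb
    _ = (ℓ : ℝ≥0∞) ^ 2 * ∫⁻ x in Ω, ‖vel u x‖ₑ * ‖vel w x‖ₑ * ‖grad v x‖ₑ :=
        lintegral_const_mul' _ _ (by simp)
    _ ≤ (ℓ : ℝ≥0∞) ^ 2 * (eLpNorm (vel u) 2 (volume.restrict Ω) ^ (1 / 2 : ℝ) *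
          eLpNorm (vel u) 6 (volume.restrict Ω) ^ (1 / 2 : ℝ) *
          eLpNorm (vel w) 6 (volume.restrict Ω) * eLpNorm (grad v) 2 (volume.restrict Ω)) := by
        gcongr
        exact lintegral_mul_mul_le (Lp.aestronglyMeasurable _) (Lp.aestronglyMeasurable _)
          (Lp.aestronglyMeasurable _)
    _ ≤ (ℓ : ℝ≥0∞) ^ 2 * (‖vel u‖ₑ ^ (1 / 2 : ℝ) * (K * ‖grad u‖ₑ) ^ (1 / 2 : ℝ) *
          (K * ‖grad w‖ₑ) * ‖grad v‖ₑ) := by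
        rw [← Lp.enorm_def, ← Lp.enorm_def]
        gcongr
        · exact hK u
        · exact hK w
    _ = _ := by
        simp only [enorm_eq_nnnorm, ENNReal.coe_mul, hs, ENNReal.coe_pow, ENNReal.coe_natCast]

/-- The convective density is integrable, and `b(u, v, w)` obeys the standard bound. -/
theorem exists_triB_bound (hℓ : ℓ = 2 ∨ ℓ = 3) (hΩb : Bornology.IsBounded Ω) :
    ∃ K : ℝ, 0 < K ∧ ∀ u v w : H01 Ω,
      Integrable (convDensity u v w) (volume.restrict Ω) ∧
      |triB u v w| ≤ K * (√‖vel u‖ * √‖grad u‖ * ‖grad v‖ * ‖grad w‖) := by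
  obtain ⟨K, hK⟩ := exists_eLpNorm_vel_le (Ω := Ω) hℓ hΩb
  -- The summand 1 only secures positivity, since the embedding constant may be 0.
  refine ⟨(ℓ : ℝ) ^ 2 * (√K * K) + 1, by positivity, fun u v w => ⟨?_, ?_⟩⟩
  · exact ⟨aestronglyMeasurable_convDensity u v w,
      (lintegral_convDensity_le hK u v w).trans_lt ENNReal.coe_lt_top⟩
  · have h := (enorm_integral_le_lintegral_enorm (μ := volume.restrict Ω)
      (convDensity u v w)).trans (lintegral_convDensity_le hK u v w)
    rw [enorm_eq_nnnorm, ENNReal.coe_le_coe, ← NNReal.coe_le_coe, coe_nnnorm,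
      ← triB_eq_integral_convDensity, Real.norm_eq_abs] at h
    refine h.trans ?_
    push_cast
    rw [Real.sqrt_mul (by positivity)]
    have : 0 ≤ √‖vel u‖ * √‖grad u‖ * ‖grad v‖ * ‖grad w‖ := by positivity
    linarith

/-- `b(u, v, w)` is additive in each argument when the convective densities are integrable. -/
theorem triB_sub_left (hi : ∀ u v w : H01 Ω, Integrable (convDensity u v w) (volume.restrict Ω))
    (u u' v w : H01 Ω) : triB (u - u') v w = triB u v w - triB u' v w := by
  simp only [triB_eq_integral_convDensity]
  rw [← integral_sub (hi _ _ _) (hi _ _ _)]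
  refine integral_congr_ae ?_
  filter_upwards [Lp.coeFn_sub (vel u) (vel u')] with x hx
  have : vel (u - u') x = vel u x - vel u' x := hx
  simp only [convDensity, this, PiLp.sub_apply, sub_mul, Finset.sum_sub_distrib]

theorem triB_sub_middle
    (hi : ∀ u v w : H01 Ω, Integrable (convDensity u v w) (volume.restrict Ω))
    (u v v' w : H01 Ω) : triB u (v - v') w = triB u v w - triB u v' w := by
  simp only [triB_eq_integral_convDensity]
  rw [← integral_sub (hi _ _ _) (hi _ _ _)]
  refine integral_congr_ae ?_
  filter_upwards [Lp.coeFn_sub (grad v) (grad v')] with x hx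
  have : grad (v - v') x = grad v x - grad v' x := hx
  simp only [convDensity, this, PiLp.sub_apply, sub_mul, mul_sub, Finset.sum_sub_distrib]

theorem triB_sub_right
    (hi : ∀ u v w : H01 Ω, Integrable (convDensity u v w) (volume.restrict Ω))
    (u v w w' : H01 Ω) : triB u v (w - w') = triB u v w - triB u v w' := by
  simp only [triB_eq_integral_convDensity]
  rw [← integral_sub (hi _ _ _) (hi _ _ _)]
  refine integral_congr_ae ?_
  filter_upwards [Lp.coeFn_sub (vel w) (vel w')] with x hx
  have : vel (w - w') x = vel w x - vel w' x := hx
  simp only [convDensity, this, PiLp.sub_apply, mul_sub, Finset.sum_sub_distrib]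

/-- By skew-symmetry, the convective terms of two velocities differ by a term that is quadratic in
their difference, tested with that difference. -/
theorem triBStar_self_sub_triBStar_self
    (hi : ∀ u v w : H01 Ω, Integrable (convDensity u v w) (volume.restrict Ω)) (u w : H01 Ω) :
    triBStar u u (u - w) - triBStar w w (u - w) = triBStar (u - w) u (u - w) := by
  have h1 := triB_sub_left hi u w u (u - w)
  have h2 := triB_sub_left hi u w (u - w) u
  have h3 := triB_sub_middle hi w u w (u - w)
  have h4 := triB_sub_right hi w (u - w) u w
  simp only [triBStar]
  -- `h3` and `h4` expand the same b(w, e, e) with e = u − w; equating them says b*(w, e, e) = 0.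
  linear_combination (1 / 2) * (h4 - h3) + (1 / 2) * (h2 - h1)

/-- The convective error term is absorbed by viscosity, up to a multiple of `‖e‖²`. -/
theorem exists_triBStar_le (hℓ : ℓ = 2 ∨ ℓ = 3) (hΩb : Bornology.IsBounded Ω) :
    ∃ C : ℝ, 0 < C ∧ (∀ u v w : H01 Ω, Integrable (convDensity u v w) (volume.restrict Ω)) ∧
      ∀ Re : ℝ, 0 < Re → ∀ e u : H01 Ω,
        |triBStar e u e| ≤ Re⁻¹ / 4 * ‖grad e‖ ^ 2 +
          C * (Re ^ 3 * ‖grad u‖ ^ 4) * ‖vel e‖ ^ 2 := by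
  obtain ⟨K, hK, h⟩ := exists_triB_bound (Ω := Ω) hℓ hΩb
  -- Young's inequality with exponents 4/3 and 4, in the form 4P³Q ≤ (P + Q)⁴. The factor 16 makes
  -- 4P³Q equal to the fourth power of the bound on b*.
  refine ⟨16 * K ^ 4, by positivity, fun u v w => (h u v w).1, fun Re hRe e u => ?_⟩
  have hT : |triBStar e u e| ≤ K * (√‖vel e‖ * √‖grad e‖ * ‖grad e‖ * ‖grad u‖) := by
    have h1 := (h e u e).2
    have h2 := (h e e u).2
    rw [triBStar, abs_mul, abs_of_pos (by norm_num : (0 : ℝ) < 1 / 2)]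
    have h3 := abs_sub (triB e u e) (triB e e u)
    rw [mul_right_comm _ ‖grad u‖] at h1
    linarith
  have hP : 0 ≤ Re⁻¹ / 4 * ‖grad e‖ ^ 2 := by positivity
  have hQ : 0 ≤ 16 * K ^ 4 * (Re ^ 3 * ‖grad u‖ ^ 4) * ‖vel e‖ ^ 2 := by positivity
  refine hT.trans (le_of_pow_le_pow_left₀ (n := 4) (by norm_num) (add_nonneg hP hQ) ?_)
  have hPQ : 4 * (Re⁻¹ / 4 * ‖grad e‖ ^ 2) ^ 3 *
      (16 * K ^ 4 * (Re ^ 3 * ‖grad u‖ ^ 4) * ‖vel e‖ ^ 2) =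
        K ^ 4 * (‖vel e‖ ^ 2 * ‖grad e‖ ^ 2 * ‖grad e‖ ^ 4 * ‖grad u‖ ^ 4) := by
    field_simp
    ring
  have hL : (K * (√‖vel e‖ * √‖grad e‖ * ‖grad e‖ * ‖grad u‖)) ^ 4 =
      K ^ 4 * (‖vel e‖ ^ 2 * ‖grad e‖ ^ 2 * ‖grad e‖ ^ 4 * ‖grad u‖ ^ 4) := by
    have hs : ∀ a : ℝ, 0 ≤ a → √a ^ 4 = a ^ 2 := fun a ha => by
      rw [show 4 = 2 * 2 by norm_num, pow_mul, Real.sq_sqrt ha]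
    simp only [mul_pow, hs _ (norm_nonneg _)]
  rw [hL, ← hPQ]
  generalize Re⁻¹ / 4 * ‖grad e‖ ^ 2 = P at hP
  generalize 16 * K ^ 4 * (Re ^ 3 * ‖grad u‖ ^ 4) * ‖vel e‖ ^ 2 = Q at hQ
  have : (P + Q) ^ 4 - 4 * P ^ 3 * Q = P ^ 4 + 6 * P ^ 2 * Q ^ 2 + 4 * P * Q ^ 3 + Q ^ 4 := by ring
  have : 0 ≤ P ^ 4 + 6 * P ^ 2 * Q ^ 2 + 4 * P * Q ^ 3 + Q ^ 4 := by positivity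
  linarith

end Trilinear

end LESROM
namespace LESROM

/-! ### The eddy viscosity closure: monotonicity and consistency -/

section Closure

/-- The map `a ↦ ‖a‖ˢ a` is monotone. -/
theorem rpow_norm_smul_monotone {E : Type*} [NormedAddCommGroup E] [InnerProductSpace ℝ E] {s : ℝ}
    (hs : 0 ≤ s) (a b : E) : ‖b‖ ^ s * inner ℝ b (a - b) ≤ ‖a‖ ^ s * inner ℝ a (a - b) := by
  have hab := real_inner_le_norm a b
  have ha : 0 ≤ ‖a‖ ^ s := by positivity
  have hb : 0 ≤ ‖b‖ ^ s := by positivity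
  -- By Cauchy–Schwarz the difference of the two sides is at least this product, which is
  -- nonnegative because t ↦ t^(s+1) is nondecreasing.
  have hm : 0 ≤ (‖a‖ ^ s * ‖a‖ - ‖b‖ ^ s * ‖b‖) * (‖a‖ - ‖b‖) := by
    rcases le_total ‖a‖ ‖b‖ with h | h
    · refine mul_nonneg_of_nonpos_of_nonpos (sub_nonpos.2 ?_) (sub_nonpos.2 h)
      gcongr
    · refine mul_nonneg (sub_nonneg.2 ?_) (sub_nonneg.2 h)
      gcongr
  rw [inner_sub_right, inner_sub_right, real_inner_self_eq_norm_sq, real_inner_self_eq_norm_sq,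
    real_inner_comm a b]
  have := mul_le_mul_of_nonneg_left hab (add_nonneg ha hb)
  linarith

variable {α E : Type*} [MeasurableSpace α] {μ : Measure α} [NormedAddCommGroup E]

theorem integrable_norm_rpow_of_memLp {p : ℝ} (hp : 0 < p) {g : α → E}
    (hg : MemLp g (ENNReal.ofReal p) μ) : Integrable (fun x => ‖g x‖ ^ p) μ := by
  have := hg.integrable_norm_rpow (by simpa using hp) ENNReal.ofReal_ne_top
  rwa [ENNReal.toReal_ofReal hp.le] at this

/-- Pointwise the integrand is at most the larger of ‖g‖ and ‖h‖ to the power s + 2, so Hölder's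
inequality is not needed. -/
theorem integrable_rpow_norm_mul_inner [InnerProductSpace ℝ E] {s : ℝ} (hs : 0 ≤ s) {g h : α → E}
    (hg : MemLp g (ENNReal.ofReal (s + 2)) μ) (hh : MemLp h (ENNReal.ofReal (s + 2)) μ) :
    Integrable (fun x => ‖g x‖ ^ s * inner ℝ (g x) (h x)) μ := by
  have hp : 0 < s + 2 := by linarith
  refine ((integrable_norm_rpow_of_memLp hp hg).add
    (integrable_norm_rpow_of_memLp hp hh)).mono' ?_ (Eventually.of_forall fun x => ?_)
  · exact (hg.1.norm.aemeasurable.pow_const s).aestronglyMeasurable.mul (hg.1.inner hh.1)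
  · have hsplit : ∀ a : ℝ, 0 ≤ a → a ^ (s + 2) = a ^ s * (a * a) := fun a ha => by
      rw [Real.rpow_add_of_nonneg ha hs (by norm_num), Real.rpow_two, sq]
    have ha := norm_nonneg (g x)
    have hb := norm_nonneg (h x)
    calc ‖‖g x‖ ^ s * inner ℝ (g x) (h x)‖
        ≤ ‖g x‖ ^ s * (‖g x‖ * ‖h x‖) := by
          rw [norm_mul, Real.norm_of_nonneg (by positivity : 0 ≤ ‖g x‖ ^ s)]
          gcongr
          exact norm_inner_le_norm _ _
      _ ≤ ‖g x‖ ^ (s + 2) + ‖h x‖ ^ (s + 2) := by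
          rcases le_total ‖g x‖ ‖h x‖ with hle | hle
          · have : ‖g x‖ ^ s * (‖g x‖ * ‖h x‖) ≤ ‖h x‖ ^ s * (‖h x‖ * ‖h x‖) := by gcongr
            rw [← hsplit _ hb] at this
            have : 0 ≤ ‖g x‖ ^ (s + 2) := by positivity
            linarith
          · have : ‖g x‖ ^ s * (‖g x‖ * ‖h x‖) ≤ ‖g x‖ ^ s * (‖g x‖ * ‖g x‖) := by gcongr
            rw [← hsplit _ ha] at this
            have : 0 ≤ ‖h x‖ ^ (s + 2) := by positivity
            linarith

theorem integral_norm_sq_eq_norm_sq [InnerProductSpace ℝ E] (g : Lp E 2 μ) :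
    ∫ x, ‖g x‖ ^ 2 ∂μ = ‖g‖ ^ 2 := by
  rw [← real_inner_self_eq_norm_sq, L2.inner_def]
  simp only [real_inner_self_eq_norm_sq]

theorem integrable_norm_sq (g : Lp E 2 μ) : Integrable (fun x => ‖g x‖ ^ 2) μ :=
  (Lp.memLp g).integrable_norm_pow two_ne_zero

theorem sq_rpow_mul_sq {a s : ℝ} (ha : 0 ≤ a) (hs : 0 ≤ s) :
    (a ^ s) ^ 2 * a ^ 2 = a ^ (2 * s + 2) := by
  rw [Real.rpow_add_of_nonneg ha (by linarith) (by norm_num), Real.rpow_two, mul_comm 2 s,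
    Real.rpow_mul ha, Real.rpow_two]

variable {ℓ : ℕ} {Ω : Set (Pt ℓ)} {CS δ ν s : ℝ}

/-- The closure form of the L-ROM is monotone. -/
theorem ladyzhenskayaClosure_monotone (hc : 0 ≤ CS * δ) (hs : 0 ≤ s) {u w : H01 Ω}
    (hu : MemLp (grad u) (ENNReal.ofReal (s + 2)) (volume.restrict Ω))
    (hw : MemLp (grad w) (ENNReal.ofReal (s + 2)) (volume.restrict Ω)) :
    ladyzhenskayaClosure CS ν s δ w (u - w) ≤ ladyzhenskayaClosure CS ν s δ u (u - w) := by
  have he : MemLp (grad (u - w)) (ENNReal.ofReal (s + 2)) (volume.restrict Ω) :=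
    (hu.sub hw).ae_eq (Lp.coeFn_sub (grad u) (grad w)).symm
  refine mul_le_mul_of_nonneg_left ?_ (by positivity)
  refine integral_mono_ae (integrable_rpow_norm_mul_inner hs hw he)
    (integrable_rpow_norm_mul_inner hs hu he) ?_
  filter_upwards [Lp.coeFn_sub (grad u) (grad w)] with x hx
  have hx' : grad (u - w) x = grad u x - grad w x := hx
  rw [hx']
  exact rpow_norm_smul_monotone hs _ _

/-- The consistency error of the closure form is absorbed by viscosity, up to the squared size of
the stress. -/
theorem ladyzhenskayaClosure_le {Re : ℝ} (hRe : 0 < Re) (hc : 0 ≤ CS * δ) (hs : 0 ≤ s)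
    {u e : H01 Ω} (hu : MemLp (grad u) (ENNReal.ofReal (s + 2)) (volume.restrict Ω))
    (he : MemLp (grad e) (ENNReal.ofReal (s + 2)) (volume.restrict Ω))
    (hu2 : MemLp (grad u) (ENNReal.ofReal (2 * s + 2)) (volume.restrict Ω)) :
    ladyzhenskayaClosure CS ν s δ u e ≤ Re⁻¹ / 4 * ‖grad e‖ ^ 2 +
      Re * ((CS * δ) ^ ν) ^ 2 * ∫ x in Ω, ‖grad u x‖ ^ (2 * s + 2) := by
  rw [ladyzhenskayaClosure, ← integral_norm_sq_eq_norm_sq (grad e), ← integral_const_mul,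
    ← integral_const_mul, ← integral_const_mul, ← integral_add
      ((integrable_norm_sq (grad e)).const_mul _)
      ((integrable_norm_rpow_of_memLp (by linarith) hu2).const_mul _)]
  refine integral_mono ((integrable_rpow_norm_mul_inner hs hu he).const_mul _)
    (((integrable_norm_sq (grad e)).const_mul _).add
      ((integrable_norm_rpow_of_memLp (by linarith) hu2).const_mul _)) fun x => ?_
  have hcν : 0 ≤ (CS * δ) ^ ν := by positivity
  have hs' : 0 ≤ ‖grad u x‖ ^ s := by positivity
  have h1 : (CS * δ) ^ ν * (‖grad u x‖ ^ s * inner ℝ (grad u x) (grad e x)) ≤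
      (CS * δ) ^ ν * (‖grad u x‖ ^ s * (‖grad u x‖ * ‖grad e x‖)) := by
    gcongr
    exact real_inner_le_norm _ _
  simp only
  rw [← sq_rpow_mul_sq (norm_nonneg (grad u x)) hs]
  refine h1.trans ?_
  generalize (CS * δ) ^ ν = c
  generalize ‖grad u x‖ ^ s = a
  -- Completing the square; this fixes the factor Re in front of the stress.
  have h2 : Re⁻¹ / 4 * ‖grad e x‖ ^ 2 + Re * c ^ 2 * (a ^ 2 * ‖grad u x‖ ^ 2) -
      c * (a * (‖grad u x‖ * ‖grad e x‖)) =
        Re⁻¹ * (‖grad e x‖ / 2 - Re * c * a * ‖grad u x‖) ^ 2 := by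
    field_simp
    ring
  have h3 : 0 ≤ Re⁻¹ * (‖grad e x‖ / 2 - Re * c * a * ‖grad u x‖) ^ 2 := by positivity
  linarith

/-- The accumulated squared `L²` size of the stress is a power of `δ` times a fixed number. -/
theorem closureSize_eq {Δt : ℝ} (hc : 0 ≤ CS * δ) (hs : 0 ≤ s) (M : ℕ) (u : ℕ → H01 Ω) :
    closureSize CS ν s Δt M u δ = (CS * δ) ^ (2 * ν) * gradPowSum (2 * s + 2) Δt M u := by
  rw [closureSize, gradPowSum, mul_left_comm,
    Finset.mul_sum (Finset.Icc 1 M) _ ((CS * δ) ^ (2 * ν))]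
  congr 1
  refine Finset.sum_congr rfl fun n _ => ?_
  rw [← integral_const_mul]
  congr 1 with x
  rw [norm_smul, mul_pow, Real.norm_eq_abs, sq_abs, mul_pow, mul_assoc,
    sq_rpow_mul_sq (norm_nonneg _) hs, mul_comm 2 ν, Real.rpow_mul hc, Real.rpow_two]

theorem tendsto_closureSize {Δt : ℝ} (hCS : 0 < CS) (hν : 0 < ν) (hs : 0 ≤ s) (M : ℕ)
    (u : ℕ → H01 Ω) : Tendsto (closureSize CS ν s Δt M u) (𝓝[>] 0) (𝓝 0) := by
  have hcont : Continuous fun δ : ℝ =>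
      (CS * δ) ^ (2 * ν) * gradPowSum (2 * s + 2) Δt M u :=
    ((Real.continuous_rpow_const (by linarith)).comp (continuous_const.mul continuous_id)).mul
      continuous_const
  have h0 := (hcont.tendsto 0).mono_left (nhdsWithin_le_nhds (s := Set.Ioi 0))
  simp only [mul_zero, Real.zero_rpow (by linarith : 2 * ν ≠ 0), zero_mul] at h0
  refine h0.congr' ?_
  filter_upwards [self_mem_nhdsWithin] with δ hδ
  exact (closureSize_eq (mul_pos hCS hδ).le hs M u).symm

theorem smagorinskyClosure_eq (CS : ℝ) :
    (smagorinskyClosure CS : ℝ → H01 Ω → H01 Ω → ℝ) = ladyzhenskayaClosure CS 2 1 := by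
  funext δ w v
  simp only [smagorinskyClosure, ladyzhenskayaClosure, Real.rpow_two, Real.rpow_one]

end Closure

/-! ### Error estimate, limit consistency and rate -/

section Error

variable {ℓ : ℕ} {Ω : Set (Pt ℓ)}

theorem vel_sub (u v : H01 Ω) : vel (u - v) = vel u - vel v := rfl

theorem grad_sub (u v : H01 Ω) : grad (u - v) = grad u - grad v := rfl

/-- Passes the integrability assumed of the basis gradients on to every ROM solution and error. -/
theorem memLp_grad_of_mem_romSpace {d r : ℕ} {φ : Fin d → H01 Ω} {p : ℝ≥0∞}
    (hφ : ∀ j, MemLp (grad (φ j)) p (volume.restrict Ω)) {v : H01 Ω} (hv : v ∈ romSpace φ r) :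
    MemLp (grad v) p (volume.restrict Ω) := by
  induction hv using Submodule.span_induction with
  | mem v hv =>
    obtain ⟨j, -, rfl⟩ := hv
    exact hφ j
  | zero => exact MemLp.zero.ae_eq (Lp.coeFn_zero (Mat ℓ) 2 (volume.restrict Ω)).symm
  | add v w _ _ hv hw => exact (hv.add hw).ae_eq (Lp.coeFn_add (grad v) (grad w)).symm
  | smul c v _ hv => exact (hv.const_smul c).ae_eq (Lp.coeFn_smul c (grad v)).symm

/-- The velocity of the `L²` projection is unique. -/
theorem IsL2Proj.vel_eq {X : Submodule ℝ (H01 Ω)} {u p q : H01 Ω} (hp : IsL2Proj X u p)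
    (hq : IsL2Proj X u q) : vel p = vel q := by
  have h := (hp.2 _ (X.sub_mem hp.1 hq.1)).trans (hq.2 _ (X.sub_mem hp.1 hq.1)).symm
  rw [← sub_eq_zero, ← inner_self_eq_zero (𝕜 := ℝ), inner_sub_left, ← vel_sub, h, sub_self]

/-- One time step of the error estimate between the G-ROM and the L-ROM. -/
theorem error_step {C Re Δt CS δ ν s : ℝ}
    (hi : ∀ u v w : H01 Ω, Integrable (convDensity u v w) (volume.restrict Ω))
    (hb : ∀ Re : ℝ, 0 < Re → ∀ e u : H01 Ω, |triBStar e u e| ≤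
      Re⁻¹ / 4 * ‖grad e‖ ^ 2 + C * (Re ^ 3 * ‖grad u‖ ^ 4) * ‖vel e‖ ^ 2)
    (hRe : 0 < Re) (hΔt : 0 < Δt) (hc : 0 ≤ CS * δ) (hs : 0 ≤ s)
    {X : Submodule ℝ (H01 Ω)}
    (hX : ∀ v ∈ X, MemLp (grad v) (ENNReal.ofReal (s + 2)) (volume.restrict Ω))
    {M : ℕ} {f : ℝ → L2Vel Ω} {u w : ℕ → H01 Ω} (hu : IsGROMSolution X Re Δt M f u)
    (hw : IsLESROMSolution X Re Δt M f (ladyzhenskayaClosure CS ν s δ) w) {n : ℕ} (hn : n < M)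
    (hu2 : MemLp (grad (u (n + 1))) (ENNReal.ofReal (2 * s + 2)) (volume.restrict Ω)) :
    (1 - Δt * (2 * C * (Re ^ 3 * ‖grad (u (n + 1))‖ ^ 4))) * ‖vel (u (n + 1) - w (n + 1))‖ ^ 2 ≤
      ‖vel (u n - w n)‖ ^ 2 + 2 * Δt * Re * ((CS * δ) ^ ν) ^ 2 *
        ∫ x in Ω, ‖grad (u (n + 1)) x‖ ^ (2 * s + 2) := by
  have hu1 := hu.1 (n + 1) hn
  have hw1 := hw.1 (n + 1) hn
  have he1 := X.sub_mem hu1 hw1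
  have hmono := ladyzhenskayaClosure_monotone (ν := ν) hc hs (hX _ hu1) (hX _ hw1)
  have hcons := ladyzhenskayaClosure_le (ν := ν) hRe hc hs (hX _ hu1) (hX _ he1) hu2
  have hconv := (abs_le.1 (hb Re hRe (u (n + 1) - w (n + 1)) (u (n + 1)))).1
  have heq := triBStar_self_sub_triBStar_self hi (u (n + 1)) (w (n + 1))
  have hgu := hu.2 n hn _ he1
  have hgw := hw.2 n hn _ he1
  set e1 := u (n + 1) - w (n + 1) with he1_def
  have hvisc : inner ℝ (grad (u (n + 1))) (grad e1) - inner ℝ (grad (w (n + 1))) (grad e1) =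
      ‖grad e1‖ ^ 2 := by
    rw [← inner_sub_left, ← grad_sub, real_inner_self_eq_norm_sq]
  have htime : inner ℝ (vel (u (n + 1)) - vel (u n)) (vel e1) -
      inner ℝ (vel (w (n + 1)) - vel (w n)) (vel e1) =
        ‖vel e1‖ ^ 2 - inner ℝ (vel (u n - w n)) (vel e1) := by
    rw [← real_inner_self_eq_norm_sq, ← inner_sub_left, ← inner_sub_left, he1_def]
    simp only [vel_sub]
    congr 1
    abel
  have hcs : inner ℝ (vel (u n - w n)) (vel e1) ≤ (‖vel (u n - w n)‖ ^ 2 + ‖vel e1‖ ^ 2) / 2 := by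
    have := real_inner_le_norm (vel (u n - w n)) (vel e1)
    have := two_mul_le_add_sq ‖vel (u n - w n)‖ ‖vel e1‖
    linarith
  have hRe' : 0 ≤ Re⁻¹ * ‖grad e1‖ ^ 2 := by positivity
  -- Convection and closure each use a quarter of the viscous term; the remaining half is
  -- nonnegative and dropped.
  have hmain : (1 / Δt) * (‖vel e1‖ ^ 2 - inner ℝ (vel (u n - w n)) (vel e1)) ≤
      C * (Re ^ 3 * ‖grad (u (n + 1))‖ ^ 4) * ‖vel e1‖ ^ 2 +
        Re * ((CS * δ) ^ ν) ^ 2 * ∫ x in Ω, ‖grad (u (n + 1)) x‖ ^ (2 * s + 2) := by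
    rw [← htime]
    have hvisc' := congrArg (fun t => Re⁻¹ * t) hvisc
    simp only [mul_sub] at hvisc' ⊢
    linarith
  rw [one_div, inv_mul_le_iff₀ hΔt] at hmain
  linarith

/-- The error between the G-ROM and the L-ROM is of order `δ ^ ν`. -/
theorem exists_error_bound {C Re Δt CS ν s : ℝ}
    (hi : ∀ u v w : H01 Ω, Integrable (convDensity u v w) (volume.restrict Ω))
    (hb : ∀ Re : ℝ, 0 < Re → ∀ e u : H01 Ω, |triBStar e u e| ≤
      Re⁻¹ / 4 * ‖grad e‖ ^ 2 + C * (Re ^ 3 * ‖grad u‖ ^ 4) * ‖vel e‖ ^ 2)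
    (hRe : 0 < Re) (hΔt : 0 < Δt) (hCS : 0 < CS) (hs : 0 ≤ s)
    {X : Submodule ℝ (H01 Ω)}
    (hX : ∀ v ∈ X, MemLp (grad v) (ENNReal.ofReal (s + 2)) (volume.restrict Ω))
    {M : ℕ} {f : ℝ → L2Vel Ω} {u : ℕ → H01 Ω} (hu : IsGROMSolution X Re Δt M f u)
    (hsmall : ∀ n ∈ Set.Icc 1 M, Δt * (2 * C * (Re ^ 3 * ‖grad (u n)‖ ^ 4)) < 1)
    (hu2 : ∀ n ∈ Set.Icc 1 M,
      MemLp (grad (u n)) (ENNReal.ofReal (2 * s + 2)) (volume.restrict Ω)) :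
    ∃ A : ℝ, 0 ≤ A ∧ ∀ δ > 0, ∀ w : ℕ → H01 Ω,
      IsLESROMSolution X Re Δt M f (ladyzhenskayaClosure CS ν s δ) w → vel (u 0) = vel (w 0) →
      ∀ n ≤ M, ‖vel (u n - w n)‖ ≤ A * δ ^ ν := by
  -- The constant may depend on n but is chosen before δ and w.
  have hsq : ∀ n, ∃ A : ℝ, 0 ≤ A ∧ (n ≤ M → ∀ δ > 0, ∀ w : ℕ → H01 Ω,
      IsLESROMSolution X Re Δt M f (ladyzhenskayaClosure CS ν s δ) w → vel (u 0) = vel (w 0) →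
      ‖vel (u n - w n)‖ ^ 2 ≤ A * (δ ^ ν) ^ 2) := by
    intro n
    induction n with
    | zero =>
      refine ⟨0, le_rfl, fun _ δ _ w _ h0 => ?_⟩
      rw [vel_sub, h0]
      simp
    | succ n ih =>
      obtain ⟨A, hA, ih⟩ := ih
      by_cases hn : n + 1 ≤ M
      swap
      · exact ⟨0, le_rfl, fun h => absurd h hn⟩
      have hmem : n + 1 ∈ Set.Icc 1 M := ⟨by omega, hn⟩
      have hθ : 0 < 1 - Δt * (2 * C * (Re ^ 3 * ‖grad (u (n + 1))‖ ^ 4)) :=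
        sub_pos.2 (hsmall _ hmem)
      have hG : 0 ≤ ∫ x in Ω, ‖grad (u (n + 1)) x‖ ^ (2 * s + 2) :=
        integral_nonneg fun x => by positivity
      refine ⟨(A + 2 * Δt * Re * (CS ^ ν) ^ 2 * ∫ x in Ω, ‖grad (u (n + 1)) x‖ ^ (2 * s + 2)) /
        (1 - Δt * (2 * C * (Re ^ 3 * ‖grad (u (n + 1))‖ ^ 4))), by positivity,
        fun _ δ hδ w hw h0 => ?_⟩
      have hstep := error_step hi hb hRe hΔt (mul_pos hCS hδ).le hs hX hu hw hn (hu2 _ hmem)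
      have hprev := ih (by omega) δ hδ w hw h0
      rw [Real.mul_rpow hCS.le hδ.le, mul_pow] at hstep
      rw [div_mul_eq_mul_div, le_div_iff₀ hθ]
      linarith
  choose A hA hbound using hsq
  -- The sum dominates each A n, giving one constant for all time levels.
  refine ⟨√(∑ n ∈ Finset.range (M + 1), A n), Real.sqrt_nonneg _, fun δ hδ w hw h0 n hn => ?_⟩
  have hle : A n ≤ ∑ n ∈ Finset.range (M + 1), A n :=
    Finset.single_le_sum (fun i _ => hA i) (Finset.mem_range.2 (by omega))
  have hδν : 0 ≤ δ ^ ν := by positivity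
  refine le_of_sq_le_sq ?_ (mul_nonneg (Real.sqrt_nonneg _) hδν)
  rw [mul_pow, Real.sq_sqrt ((hA n).trans hle)]
  exact (hbound n hn δ hδ w hw h0).trans (by gcongr)

theorem triNorm_top_zero_le_iff {Δt : ℝ} {M : ℕ} {e : ℕ → H01 Ω} {c : ℝ} :
    triNorm ⊤ 0 Δt M e ≤ c ↔ ∀ n ≤ M, ‖vel (e n)‖ ≤ c := by
  simp [triNorm, sobolevNorm, Finset.sup'_le_iff]

/-- Error bounds of order `δ ^ ν` in every dimension imply limit consistency. -/
theorem isLimitConsistent_of_error_bound {d M : ℕ} {φ : Fin d → H01 Ω} {Re Δt ν : ℝ}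
    {f : ℝ → L2Vel Ω} {u : ℕ → ℕ → H01 Ω} {τ : ℝ → H01 Ω → H01 Ω → ℝ} (hν : 0 < ν)
    (hu0 : ∀ r ∈ Set.Icc 1 d, IsL2Proj (romSpace φ r) (u d 0) (u r 0))
    (h : ∀ r ∈ Set.Icc 1 d, ∃ A : ℝ, 0 ≤ A ∧ ∀ δ > 0, ∀ w : ℕ → H01 Ω,
      IsLESROMSolution (romSpace φ r) Re Δt M f (τ δ) w → vel (u r 0) = vel (w 0) →
      ∀ n ≤ M, ‖vel (u r n - w n)‖ ≤ A * δ ^ ν) :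
    IsLimitConsistent ⊤ 0 φ Re Δt M f (u d) τ := by
  obtain ⟨A, hA, hAb⟩ : ∃ A : ℝ, 0 < A ∧ ∀ r ∈ Set.Icc 1 d, ∀ δ > 0, ∀ w : ℕ → H01 Ω,
      IsLESROMSolution (romSpace φ r) Re Δt M f (τ δ) w → vel (u r 0) = vel (w 0) →
      ∀ n ≤ M, ‖vel (u r n - w n)‖ ≤ A * δ ^ ν := by
    choose! A hA0 hA using h
    obtain ⟨A', hA'⟩ := ((Finset.Icc 1 d).image A).exists_le
    -- Positivity of A makes B strictly increasing in δ; likewise E > 0 below makes it strictly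
    -- decreasing in r.
    refine ⟨max A' 1, by positivity, fun r hr δ hδ w hw h0 n hn => ?_⟩
    refine (hA r hr δ hδ w hw h0 n hn).trans ?_
    have : A r ≤ A' := hA' _ (Finset.mem_image_of_mem A (Finset.mem_Icc.2 hr))
    have : A r ≤ max A' 1 := this.trans (le_max_left _ _)
    have : 0 ≤ δ ^ ν := by positivity
    gcongr
  obtain ⟨E, hE, hEb⟩ : ∃ E : ℝ, 0 < E ∧ ∀ r ∈ Set.Icc 1 d, ∀ n ≤ M,
      ‖vel (u d n - u r n)‖ ≤ E := by
    obtain ⟨E, hE⟩ := ((Finset.Icc 1 d).image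
      fun r => triNorm ⊤ 0 Δt M fun n => u d n - u r n).exists_le
    refine ⟨max E 1, by positivity, fun r hr => triNorm_top_zero_le_iff (Δt := Δt).1 ?_⟩
    exact (hE _ (Finset.mem_image_of_mem _ (Finset.mem_Icc.2 hr))).trans (le_max_left _ _)
  -- The factor d − r is at least 1 for r < d, so the first term bounds u_d − u_r, and it is 0 at r
  -- = d.
  refine ⟨fun δ r => ((d : ℝ) - r) * E + A * δ ^ ν, fun δ hδ r hr w hw hw0 => ?_,
    fun r _ δ hδ δ' _ hlt => ?_, fun δ _ r _ r' _ hlt => ?_, ?_⟩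
  · refine triNorm_top_zero_le_iff.2 fun n hn => ?_
    have h1 : ‖vel (u d n - u r n)‖ ≤ ((d : ℝ) - r) * E := by
      rcases hr.2.eq_or_lt with rfl | hlt
      · rw [vel_sub]
        simp
      · refine (hEb r hr n hn).trans (le_mul_of_one_le_left hE.le ?_)
        have : (r : ℝ) + 1 ≤ d := by exact_mod_cast hlt
        linarith
    have h2 := hAb r hr δ hδ w hw ((hu0 r hr).vel_eq hw0) n hn
    calc ‖vel (u d n - w n)‖ = ‖vel (u d n - u r n) + vel (u r n - w n)‖ := by
          simp only [vel_sub, sub_add_sub_cancel]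
      _ ≤ _ := (norm_add_le _ _).trans (add_le_add h1 h2)
  · have : δ ^ ν < δ' ^ ν := Real.rpow_lt_rpow (le_of_lt hδ) hlt hν
    simp only
    gcongr
  · have : (r : ℝ) < r' := by exact_mod_cast hlt
    simp only
    gcongr
  · have hcont : Continuous fun δ : ℝ => A * δ ^ ν :=
      continuous_const.mul (Real.continuous_rpow_const hν.le)
    have h0 := (hcont.tendsto 0).mono_left (nhdsWithin_le_nhds (s := Set.Ioi 0))
    simpa [Real.zero_rpow hν.ne'] using h0

/-- Error bounds of order `δ ^ ν` give convergence at that rate. -/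
theorem convergesAtRate_of_error_bound {d r M : ℕ} {φ : Fin d → H01 Ω} {Re Δt ν : ℝ}
    {f : ℝ → L2Vel Ω} {u : ℕ → H01 Ω} {τ : ℝ → H01 Ω → H01 Ω → ℝ} (hu0 : u 0 ∈ romSpace φ r)
    (h : ∃ A : ℝ, 0 ≤ A ∧ ∀ δ > 0, ∀ w : ℕ → H01 Ω,
      IsLESROMSolution (romSpace φ r) Re Δt M f (τ δ) w → vel (u 0) = vel (w 0) →
      ∀ n ≤ M, ‖vel (u n - w n)‖ ≤ A * δ ^ ν) :
    ConvergesAtRate ν φ r Re Δt M f u τ := by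
  obtain ⟨A, -, hA⟩ := h
  refine ⟨A, fun δ hδ w hw hw0 => triNorm_top_zero_le_iff.2 ?_⟩
  have hself : IsL2Proj (romSpace φ r) (u 0) (u 0) := ⟨hu0, fun _ _ => rfl⟩
  exact hA δ hδ w hw (hself.vel_eq hw0)

end Error

end LESROM

/-! ### The main theorem -/

theorem theorem3 (ℓ : ℕ) (hℓ : ℓ = 2 ∨ ℓ = 3) (Ω : Set (Pt ℓ)) (hΩ : IsOpen Ω)
    (hΩb : Bornology.IsBounded Ω) :
    -- the constant in the time step restriction depends on the domain only
    ∃ C : ℝ, 0 < C ∧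
    ∀ (d M : ℕ) (φ : Fin d → H01 Ω) (Re Δt CS : ℝ) (f : ℝ → L2Vel Ω) (u : ℕ → ℕ → H01 Ω),
      0 < Re → 0 < Δt → 0 < CS →
      Orthonormal ℝ (fun j => vel (φ j)) →
      -- `u r` is a solution of the `r`-dimensional G-ROM that starts from `P_r(u_d⁰)`
      (∀ r ∈ Set.Icc 1 d, IsGROMSolution (romSpace φ r) Re Δt M f (u r)) →
      (∀ r ∈ Set.Icc 1 d, IsL2Proj (romSpace φ r) (u d 0) (u r 0)) →
      -- the time step is small: `Δt dₙ < 1`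
      (∀ r ∈ Set.Icc 1 d, ∀ n ∈ Set.Icc 1 M,
        Δt * (C * (Re ^ 3 * ‖grad (u r n)‖ ^ 4 + 1)) < 1) →
      -- L-ROM
      (∀ μ s : ℝ, 0 < μ → 0 ≤ s →
        (∀ j, MemLp (grad (φ j)) (ENNReal.ofReal (s + 2)) (volume.restrict Ω)) →
        (∀ r ∈ Set.Icc 1 d, ∀ n ∈ Set.Icc 1 M,
          MemLp (grad (u r n)) (ENNReal.ofReal (2 * s + 2)) (volume.restrict Ω)) →
        IsLimitConsistent ⊤ 0 φ Re Δt M f (u d) (ladyzhenskayaClosure CS μ s) ∧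
        (∀ r ∈ Set.Icc 1 d,
          (∀ δ > 0, closureSize CS μ s Δt M (u r) δ =
            (CS * δ) ^ (2 * μ) * gradPowSum (2 * s + 2) Δt M (u r)) ∧
          Tendsto (closureSize CS μ s Δt M (u r)) (𝓝[>] 0) (𝓝 0) ∧
          ConvergesAtRate μ φ r Re Δt M f (u r) (ladyzhenskayaClosure CS μ s))) ∧
      -- S-ROM
      ((∀ j, MemLp (grad (φ j)) 3 (volume.restrict Ω)) →
        (∀ r ∈ Set.Icc 1 d, ∀ n ∈ Set.Icc 1 M,
          MemLp (grad (u r n)) 4 (volume.restrict Ω)) →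
        IsLimitConsistent ⊤ 0 φ Re Δt M f (u d) (smagorinskyClosure CS) ∧
        ∀ r ∈ Set.Icc 1 d, ConvergesAtRate 2 φ r Re Δt M f (u r) (smagorinskyClosure CS)) := by

  obtain ⟨C, hC, hi, hb⟩ := exists_triBStar_le (Ω := Ω) hℓ hΩb
  -- The 2 comes from multiplying the energy inequality by 2Δt to clear the ½ left by Young's
  -- inequality in the time difference.
  refine ⟨2 * C, by positivity, ?_⟩
  intro d M φ Re Δt CS f u hRe hΔt hCS _ hu hu0 hsmall
  have hbound : ∀ μ s : ℝ, 0 ≤ s →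
      (∀ j, MemLp (grad (φ j)) (ENNReal.ofReal (s + 2)) (volume.restrict Ω)) →
      (∀ r ∈ Set.Icc 1 d, ∀ n ∈ Set.Icc 1 M,
        MemLp (grad (u r n)) (ENNReal.ofReal (2 * s + 2)) (volume.restrict Ω)) →
      ∀ r ∈ Set.Icc 1 d, ∃ A : ℝ, 0 ≤ A ∧ ∀ δ > 0, ∀ w : ℕ → H01 Ω,
        IsLESROMSolution (romSpace φ r) Re Δt M f (ladyzhenskayaClosure CS μ s δ) w →
        vel (u r 0) = vel (w 0) → ∀ n ≤ M, ‖vel (u r n - w n)‖ ≤ A * δ ^ μ := by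
    intro μ s hs hφ hu2 r hr
    refine exists_error_bound hi hb hRe hΔt hCS hs
      (fun v hv => memLp_grad_of_mem_romSpace hφ hv) (hu r hr) (fun n hn => ?_) (hu2 r hr)
    have h1 := hsmall r hr n hn
    -- The extra 1 in the time step restriction is spare and is discarded here.
    have h2 : 0 < Δt * (2 * C) := by positivity
    linarith
  refine ⟨fun μ s hμ hs hφ hu2 => ⟨?_, fun r hr => ⟨?_, ?_, ?_⟩⟩, fun hφ hu2 => ?_⟩
  · exact isLimitConsistent_of_error_bound hμ hu0 (hbound μ s hs hφ hu2)
  · exact fun δ hδ => closureSize_eq (mul_pos hCS hδ).le hs M (u r)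
  · exact tendsto_closureSize hCS hμ hs M (u r)
  · exact convergesAtRate_of_error_bound ((hu r hr).1 0 (Nat.zero_le M))
      (hbound μ s hs hφ hu2 r hr)
  · have h3 : ENNReal.ofReal (1 + 2) = 3 := by norm_num
    have h4 : ENNReal.ofReal (2 * 1 + 2) = 4 := by norm_num
    have hS := hbound 2 1 zero_le_one (by rwa [h3]) (by rwa [h4])
    rw [smagorinskyClosure_eq]
    exact ⟨isLimitConsistent_of_error_bound two_pos hu0 hS, fun r hr =>
      convergesAtRate_of_error_bound ((hu r hr).1 0 (Nat.zero_le M)) (hS r hr)⟩
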